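/- Let $I$ be a finite set, let $\Delta=\{(j,j):j\in I\}\subseteq J\subseteq I\times I$, and let $A=(\alpha_{i,j})_{(i,j)\in J}$ be an array of positive real numbers. Let $\mathcal F_{j,j}=\mathbb C\xi_{j,j}\oplus\bigoplus_{n\ge1}(\mathbb C e_{j,j})^{\otimes n}$ (free Fock space) and, for $(i,j)\in J$ with $i\ne j$, $\mathcal F_{i,j}=\mathbb C\xi_{i,j}\oplus\mathbb C e_{i,j}$ (boolean Fock space), where all $\xi_{i,j}$, $e_{i,j}$ are unit vectors. With $\mathcal F^0_{i,j}=\mathcal F_{i,j}\ominus\mathbb C\xi_{i,j}$, the matricially free-boolean Fock space is $$\mathcal F=\mathbb C\xi\oplus\bigoplus_{m\ge1}\ \bigoplus_{(i_1,i_2)\ne(i_2,i_3)\ne\cdots\ne(i_m,i_m)}\mathcal F^0_{i_1,i_2}\otimes\mathcal F^0_{i_2,i_3}\otimes\cdots\otimes\mathcal F^0_{i_m,i_m},$$ all pairs being in $J$. Let $\tau$ be the canonical isometric embedding of $\mathcal F$ into the free Fock space over $\bigoplus_{(i,j)\in J}\mathbb C e_{i,j}$, let $\ell(e_{i,j})$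 be the free creation operators, and put $\varsigma_{i,j}=\alpha_{i,j}\,\tau^*\ell(e_{i,j})\tau$ and $\zeta_{i,j}=\varsigma_{i,j}+\varsigma_{i,j}^*$ in $B(\mathcal F)$. Let $\varphi$ be the vector state of $\xi$ and $\psi_j$ the vector state of $e_{j,j}$ on $B(\mathcal F)$, and let $\varphi_{j,j}=\varphi$ for all $j\in I$ and $\varphi_{i,j}=\psi_j$ for $(i,j)\in J$, $i\neq j$. Then: 1. for every $j\in I$, the $\varphi$-distribution of $\zeta_{j,j}$ is the semicircle law of radius $2\alpha_{j,j}$; 2. for every $(i,j)\in J$ with $i\ne j$, the $\psi_j$-distribution of $\zeta_{i,j}$ is the Bernoulli law $\tfrac12(\delta_{\alpha_{i,j}}+\delta_{-\alpha_{i,j}})$; 3. the array $(\zeta_{i,j})_{(i,j)\in J}$ is matricially free with respect to $(\varphi_{i,j})$. Here the $\phi$-distribution of $a$ is the probability measure on $\mathbb R$ with moments $\phi(a^n)$, $n\ge 0$, and (3) means the following. There are projections $1_{i,j}\in B(\mathcal F)$, $(i,j)\in J$, such that, with $\mathcal A_{i,j}$ the *-algebra generated by $\zeta_{i,j}$ and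 $1_{i,j}$, and $\mathcal I$ the unital algebra generated by all the $1_{i,j}$: each $1_{i,j}$ is an identity of $\mathcal A_{i,j}$, the algebra $\mathcal I$ is commutative, and for every diagonal state $\phi=\varphi_{k,k}$ * (a) $\phi(a_1\cdots a_m)=0$ whenever $m\ge1$, $a_k\in\mathcal A_{i_k,j_k}\cap\operatorname{Ker}\varphi_{i_k,j_k}$ for $1\le k\le m$ and $(i_1,j_1)\ne\cdots\ne(i_m,j_m)$ (neighbouring pairs are different); * (b) $\phi(u_1au_2)=\phi(u_1)\phi(a)\phi(u_2)$ for all $a\in B(\mathcal F)$ and $u_1,u_2\in\mathcal I$; * (c) if $m\ge2$, $a\in B(\mathcal F)$, $a_k\in\mathcal A_{i_k,j_k}\cap\operatorname{Ker}\varphi_{i_k,j_k}$ for $1<k\le m$ and $(i_1,j_1)\ne\cdots\ne(i_m,j_m)$, then $\phi(a\,1_{i_1,j_1}a_2\cdots a_m)$ equals $\phi(a\,a_2\cdots a_m)$ if $j_k=i_{k+1}$ for all $1\le k<m$, and $0$ otherwise. -/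

import Mathlib

open scoped lp ComplexOrder

noncomputable section

namespace MatricialFreeness

universe u v

/-! ### Matricial freeness in a unital *-algebra -/

section Freeness

variable {I : Type u} {A : Type v} [Ring A] [StarRing A] [Algebra ℂ A]

/-- A state on a unital *-algebra: a normalized positive linear functional. -/
structure IsState (φ : A →ₗ[ℂ] ℂ) : Prop where
  normalized : φ 1 = 1
  positive : ∀ a : A, 0 ≤ φ (star a * a)

/-- The array of functionals defined by `φ` and the family `ψ`: the functional `φ` on the
diagonal, and `ψ j` at the off-diagonal places `(i, j)` of the `j`-th column. -/
def stateArray [DecidableEq I] (J : Set (I × I)) (φ : A →ₗ[ℂ] ℂ) (ψ : I → A →ₗ[ℂ] ℂ)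
    (p : J) : A →ₗ[ℂ] ℂ :=
  if p.1.1 = p.1.2 then φ else ψ p.1.2

variable {J : Set (I × I)}

/-- Membership of a sequence of pairs in
`Λ = ⋃ₘ {((i₁,i₂), (i₂,i₃), …, (iₘ,iₘ₊₁)) : (i₁,i₂) ≠ (i₂,i₃) ≠ … ≠ (iₘ,iₘ₊₁)}`. -/
def InLambda (w : List J) : Prop :=
  w ≠ [] ∧ w.IsChain (fun p q => p ≠ q ∧ p.1.2 = q.1.1)

/-- `l` lists pairs `(p₁, a₁), …, (pₘ, aₘ)` with `aₖ ∈ 𝒜 pₖ ∩ Ker φ pₖ` for each `k`. -/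
def IsCentered (φ : J → A →ₗ[ℂ] ℂ) (𝒜 : J → NonUnitalStarSubalgebra ℂ A)
    (l : List (J × A)) : Prop :=
  ∀ x ∈ l, x.2 ∈ 𝒜 x.1 ∧ φ x.1 x.2 = 0

/-- The product `a₁ a₂ ⋯ aₘ` of the elements of a list of labelled elements. -/
def wordProd (l : List (J × A)) : A := (l.map Prod.snd).prod

/-- `e` is an array of internal units of the *-subalgebras `𝒜 p`: each `e p` is a projection in
`𝒜 p` which is an identity of `𝒜 p`, and the unital algebra generated by all of them is
commutative. -/
structure IsInternalUnits (𝒜 : J → NonUnitalStarSubalgebra ℂ A) (e : J → A) : Prop where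
  mem : ∀ p, e p ∈ 𝒜 p
  projection : ∀ p, IsStarProjection (e p)
  mul_unit : ∀ p, ∀ a ∈ 𝒜 p, a * e p = a
  unit_mul : ∀ p, ∀ a ∈ 𝒜 p, e p * a = a
  commutative : ∀ x ∈ Algebra.adjoin ℂ (Set.range e), ∀ y ∈ Algebra.adjoin ℂ (Set.range e),
    x * y = y * x

open Classical in
/-- `e` is a matricially free array of units associated with `𝒜` and `φ`. In the second condition
there is at least one factor to the right of the unit. -/
structure IsMatriciallyFreeUnits (φ : J → A →ₗ[ℂ] ℂ) (𝒜 : J → NonUnitalStarSubalgebra ℂ A)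
    (e : J → A) : Prop where
  factor : ∀ d : J, d.1.1 = d.1.2 → ∀ a : A,
    ∀ u₁ ∈ Algebra.adjoin ℂ (Set.range e), ∀ u₂ ∈ Algebra.adjoin ℂ (Set.range e),
      φ d (u₁ * a * u₂) = φ d u₁ * φ d a * φ d u₂
  unit : ∀ d : J, d.1.1 = d.1.2 → ∀ (a : A) (p : J) (l : List (J × A)), l ≠ [] →
    IsCentered φ 𝒜 l → (p :: l.map Prod.fst).IsChain (· ≠ ·) →
      φ d (a * e p * wordProd l) =
        if InLambda (p :: l.map Prod.fst) then φ d (a * wordProd l) else 0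

/-- The array `𝒜` of *-subalgebras with internal units `e` is matricially free with respect to the
array `φ` of states. -/
structure IsMatriciallyFreeAlgebras (φ : J → A →ₗ[ℂ] ℂ)
    (𝒜 : J → NonUnitalStarSubalgebra ℂ A) (e : J → A) : Prop where
  states : ∀ p, IsState (φ p)
  internal : IsInternalUnits 𝒜 e
  free : ∀ d : J, d.1.1 = d.1.2 → ∀ l : List (J × A), l ≠ [] →
    IsCentered φ 𝒜 l → (l.map Prod.fst).IsChain (· ≠ ·) → φ d (wordProd l) = 0
  units : IsMatriciallyFreeUnits φ 𝒜 e

/-- The array `a` of elements of a unital *-algebra is (*-)matricially free with respect to `φ`: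
for some array of projections `e`, the *-algebras generated by `a p` and `e p` are matricially free
with internal units `e p`. -/
def IsMatriciallyFree [StarModule ℂ A] (φ : J → A →ₗ[ℂ] ℂ) (a : J → A) : Prop :=
  ∃ e : J → A,
    IsMatriciallyFreeAlgebras φ (fun p => NonUnitalStarAlgebra.adjoin ℂ {a p, e p}) e

end Freeness

/-! ### Distributions -/

/-- `μ` is the `φ`-distribution of `a`: a probability measure on the line with all moments finite
whose moments are those of `a` under `φ`. -/
structure HasDistribution {A : Type v} [Ring A] [Algebra ℂ A] (φ : A →ₗ[ℂ] ℂ) (a : A)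
    (μ : MeasureTheory.Measure ℝ) : Prop where
  prob : MeasureTheory.IsProbabilityMeasure μ
  integrable : ∀ n : ℕ, MeasureTheory.Integrable (fun x : ℝ => x ^ n) μ
  moment : ∀ n : ℕ, φ (a ^ n) = ((∫ x : ℝ, x ^ n ∂μ : ℝ) : ℂ)

/-- The semicircle law of radius `R`, with density `2 / (π R²) √(R² - x²)` on `[-R, R]` (the real
square root vanishes outside that interval). -/
def semicircleLaw (R : ℝ) : MeasureTheory.Measure ℝ :=
  MeasureTheory.volume.withDensity
    (fun x : ℝ => ENNReal.ofReal (2 / (Real.pi * R ^ 2) * Real.sqrt (R ^ 2 - x ^ 2)))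

/-- The Bernoulli law with mass `1/2` at each of the points `c` and `-c`. -/
def bernoulliLaw (c : ℝ) : MeasureTheory.Measure ℝ :=
  (2⁻¹ : ENNReal) • MeasureTheory.Measure.dirac c +
    (2⁻¹ : ENNReal) • MeasureTheory.Measure.dirac (-c)

/-! ### Hilbert spaces with a labelled orthonormal basis -/

open Classical in
/-- The canonical basis vector of `ℓ²(X, ℂ)` with label `x`. -/
def basisVec {X : Type u} (x : X) : ℓ²(X, ℂ) := lp.single 2 x (1 : ℂ)

theorem orthonormal_basisVec (X : Type u) : Orthonormal ℂ (basisVec : X → ℓ²(X, ℂ)) := by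
  classical
  rw [orthonormal_iff_ite]
  intro x y
  unfold basisVec
  rw [lp.inner_single_left, lp.coeFn_single, Pi.single_apply]
  split_ifs <;> simp

/-- The isometry `ℓ²(X, ℂ) → ℓ²(Y, ℂ)` which maps the basis vector `x` to the basis
vector `f x`. -/
def basisMap {X : Type u} {Y : Type v} (f : X → Y) (hf : Function.Injective f) :
    ℓ²(X, ℂ) →ₗᵢ[ℂ] ℓ²(Y, ℂ) :=
  ((orthonormal_basisVec Y).comp f hf).orthogonalFamily.linearIsometry

/-- The vector functional `a ↦ ⟨v, a v⟩` on `B(H)`. -/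
def vectorState {H : Type u} [NormedAddCommGroup H] [InnerProductSpace ℂ H] (v : H) :
    (H →L[ℂ] H) →ₗ[ℂ] ℂ where
  toFun a := inner ℂ v (a v)
  map_add' a b := by simp
  map_smul' c a := by simp

/-! ### The matricially free-boolean Fock space -/

section Fock

variable {I : Type u} (J : Set (I × I))

/-- Labels of the simple tensors of the matricially free product of an array `(H p, ξ p)` of
Hilbert spaces, where `K p` labels an orthonormal basis of `H p ⊖ ℂ ξ p`: they are the vacuum (the
empty word) and the words `k₁ k₂ ⋯ kₘ`, with `kₗ ∈ K (iₗ, iₗ₊₁)`,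
`(i₁,i₂) ≠ (i₂,i₃) ≠ … ≠ (iₘ,iₘ₊₁)` and `iₘ₊₁ = iₘ`. -/
abbrev MFProductLabel (K : J → Type v) : Type (max u v) :=
  {w : List (Σ p : J, K p) //
    w.IsChain (fun x y => x.1 ≠ y.1 ∧ x.1.1.2 = y.1.1.1) ∧
      ∀ x ∈ w.getLast?, x.1.1.1 = x.1.1.2}

/-- Labels of the orthonormal basis `e^{⊗ n}` of `F(ℂ e) ⊖ ℂ ξ` for the Fock space at the place
`p`: all `n ≥ 1` for the free Fock space on the diagonal, only `n = 1` for the boolean Fock space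
off the diagonal. -/
abbrev FockLabel (p : J) : Type :=
  {n : ℕ // 1 ≤ n ∧ (p.1.1 ≠ p.1.2 → n = 1)}

/-- Labels of the simple tensors of the matricially free-boolean Fock space. -/
abbrev FBLabel : Type u := MFProductLabel J (FockLabel J)

/-- The matricially free-boolean Fock space over the array `(ℂ e p)`, `p ∈ J`. -/
abbrev FBFock : Type u := ℓ²(FBLabel J, ℂ)

/-- The free Fock space over `⨁_{p ∈ J} ℂ e p`, with its orthonormal basis of simple tensors
`e p₁ ⊗ ⋯ ⊗ e pₘ`. -/
abbrev FreeFock : Type u := ℓ²(List J, ℂ)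

variable {J}

/-- The free creation operator `ℓ(e p)`: tensoring with `e p` on the left. -/
def freeCreation (p : J) : FreeFock J →L[ℂ] FreeFock J :=
  (basisMap (fun w : List J => p :: w) (List.cons_injective)).toContinuousLinearMap

/-- Writing out a word of tensor powers: `(p₁, n₁) ⋯ (pₘ, nₘ)` becomes
`p₁ ⋯ p₁ p₂ ⋯ p₂ ⋯ pₘ ⋯ pₘ` with `nₗ` copies of `pₗ`. -/
def flatten (w : List (Σ p : J, FockLabel J p)) : List J :=
  w.flatMap (fun x => List.replicate x.2.1 x.1)

theorem flatten_head (p : J) (w : List (Σ p : J, FockLabel J p))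
    (hw : ∀ x ∈ w.head?, p ≠ x.1) : ∀ q ∈ (flatten w).head?, p ≠ q := by
  cases w with
  | nil => simp [flatten]
  | cons x w =>
    obtain ⟨n, hn⟩ : ∃ n, x.2.1 = n + 1 := ⟨x.2.1 - 1, by have := x.2.2.1; omega⟩
    simpa [flatten, hn, List.replicate_succ] using hw

theorem replicate_append_cancel (p : J) (u v : List J) (hu : ∀ q ∈ u.head?, p ≠ q)
    (hv : ∀ q ∈ v.head?, p ≠ q) : ∀ m n : ℕ,
    List.replicate m p ++ u = List.replicate n p ++ v → m = n ∧ u = v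
  | 0, 0, h => ⟨rfl, by simpa using h⟩
  | 0, n + 1, h => by
    simp only [List.replicate_zero, List.nil_append, List.replicate_succ, List.cons_append] at h
    subst h
    simp at hu
  | m + 1, 0, h => by
    simp only [List.replicate_zero, List.nil_append, List.replicate_succ, List.cons_append] at h
    subst h
    simp at hv
  | m + 1, n + 1, h => by
    simp only [List.replicate_succ, List.cons_append, List.cons.injEq, true_and] at h
    obtain ⟨h1, h2⟩ := replicate_append_cancel p u v hu hv m n h
    exact ⟨by rw [h1], h2⟩

theorem flatten_inj : ∀ w w' : List (Σ p : J, FockLabel J p),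
    w.IsChain (fun x y => x.1 ≠ y.1) → w'.IsChain (fun x y => x.1 ≠ y.1) →
    flatten w = flatten w' → w = w'
  | [], [], _, _, _ => rfl
  | [], ⟨p, n⟩ :: w', _, _, h => by
    have := n.2.1
    simp only [flatten, List.flatMap_nil, List.flatMap_cons] at h
    have := congrArg List.length h
    simp at this
    omega
  | ⟨p, n⟩ :: w, [], _, _, h => by
    have := n.2.1
    simp only [flatten, List.flatMap_nil, List.flatMap_cons] at h
    have := congrArg List.length h
    simp at this
    omega
  | ⟨p, n⟩ :: w, ⟨q, m⟩ :: w', h1, h2, h => by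
    rw [List.isChain_cons] at h1 h2
    have hpq : p = q := by
      obtain ⟨k, hk⟩ : ∃ k, n.1 = k + 1 := ⟨n.1 - 1, by have := n.2.1; omega⟩
      obtain ⟨l, hl⟩ : ∃ l, m.1 = l + 1 := ⟨m.1 - 1, by have := m.2.1; omega⟩
      simp only [flatten, List.flatMap_cons, hk, hl, List.replicate_succ, List.cons_append,
        List.cons.injEq] at h
      exact h.1
    subst hpq
    obtain ⟨hn, hw⟩ := replicate_append_cancel p (flatten w) (flatten w')
      (flatten_head p w h1.1) (flatten_head p w' h2.1) n.1 m.1 (by simpa [flatten] using h)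
    rw [flatten_inj w w' h1.2 h2.2 hw, Subtype.ext hn]

theorem flatten_injective : Function.Injective (fun w : FBLabel J => flatten w.1) :=
  fun w w' h => Subtype.ext (flatten_inj w.1 w'.1 (w.2.1.imp fun _ _ h => h.1)
    (w'.2.1.imp fun _ _ h => h.1) h)

/-- The canonical embedding `τ` of the matricially free-boolean Fock space into the free Fock
space. -/
def canonicalEmbedding : FBFock J →L[ℂ] FreeFock J :=
  (basisMap (fun w : FBLabel J => flatten w.1) flatten_injective).toContinuousLinearMap

/-- The matricially free creation operator `ς p = α p • τ* ℓ(e p) τ`. -/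
def creation (α : J → ℝ) (p : J) : FBFock J →L[ℂ] FBFock J :=
  (α p : ℂ) • (ContinuousLinearMap.adjoint canonicalEmbedding ∘L freeCreation p ∘L
    canonicalEmbedding)

/-- The matricially free Gaussian operator `ζ p = ς p + (ς p)*`. -/
def gaussian (α : J → ℝ) (p : J) : FBFock J →L[ℂ] FBFock J :=
  creation α p + ContinuousLinearMap.adjoint (creation α p)

variable (J) in
/-- The vacuum vector. -/
def vacuum : FBFock J :=
  basisVec ⟨[], by simp, by simp⟩

/-- The vector `e (j,j)`. -/
def diagVec (hJ : ∀ j : I, (j, j) ∈ J) (j : I) : FBFock J :=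
  basisVec ⟨[⟨⟨(j, j), hJ j⟩, ⟨1, le_refl 1, fun _ => rfl⟩⟩], by simp, by simp⟩

end Fock

end MatricialFreeness

end

open MatricialFreeness

/-! Writing tensor powers out letter by letter turns the simple tensors of the matricially
free-boolean Fock space into paths: words of consecutive pairs in `J` ending with a diagonal pair.
An off-diagonal pair cannot follow itself in a path, so the boolean truncation is automatic. Thus τ*
sends the basis vector of a word to a simple tensor if the word is a path and to zero otherwise, and
the Gaussian operator at `p` just adds or removes a leading letter `p`, with factor `α p`.

Let `v` be a path not starting with `p` such that `p :: v` is again a path. On the vectors with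
labels `v`, `p v`, `p p v`, … the Gaussian operator is a fixed Jacobi operator, independent of `v`:
the free one on the diagonal, the boolean one off it (`gaussian_fockEmbedding`). Taking `v` empty,
or the single letter `(j, j)`, reduces the two distributions to moments of Jacobi operators. These
are computed by orthogonality of the Chebyshev polynomials (`integral_freeJacobi_pow`) and by a
two-dimensional recursion (`booleanJacobi_pow`).

For freeness, the unit at `p` projects onto the simple tensors on which the Gaussian operator at `p`
can act, and every element of the algebra at `p` is a polynomial in that operator times the unit.
Independence of `v` shows that centering in the single state at `p` removes the component along `v`
for every admissible `v`. Hence a centered element sends such vectors to the span of the tensors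
headed by `p` (`centered_pathVec_mem_headSpan`). By induction an alternating centered product maps
the vacuum into such a span, which is orthogonal to the vacuum, and gives zero when consecutive
pairs do not match (`wordProd_vacuum`). -/

namespace MatricialFreeness

open MeasureTheory Polynomial

/-! ### The semicircle law -/

/-- The density of the semicircle law of radius `R`. -/
noncomputable def semicircleDensity (R x : ℝ) : ℝ :=
  2 / (Real.pi * R ^ 2) * Real.sqrt (R ^ 2 - x ^ 2)

theorem semicircleDensity_nonneg (R x : ℝ) : 0 ≤ semicircleDensity R x := by
  unfold semicircleDensity
  positivity

theorem continuous_semicircleDensity (R : ℝ) : Continuous (semicircleDensity R) := by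
  unfold semicircleDensity
  fun_prop

theorem semicircleDensity_eq_zero {R x : ℝ} (hR : 0 < R) (hx : x ∉ Set.Icc (-R) R) :
    semicircleDensity R x = 0 := by
  unfold semicircleDensity
  rw [Real.sqrt_eq_zero_of_nonpos, mul_zero]
  by_contra! h
  exact hx (abs_le.1 (abs_le_of_sq_le_sq (by linarith) hR.le))

theorem integrable_semicircleDensity_mul {R : ℝ} (hR : 0 < R) {f : ℝ → ℝ} (hf : Continuous f) :
    Integrable (fun x => semicircleDensity R x * f x) := by
  refine ((continuous_semicircleDensity R).mul hf).integrable_of_hasCompactSupport ?_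
  refine HasCompactSupport.intro (isCompact_Icc (a := -R) (b := R)) fun x hx => ?_
  rw [Pi.mul_apply, semicircleDensity_eq_zero hR hx, zero_mul]

theorem integrable_semicircleLaw {R : ℝ} (hR : 0 < R) {f : ℝ → ℝ} (hf : Continuous f) :
    Integrable f (semicircleLaw R) := by
  have hm : Measurable fun x => ENNReal.ofReal (semicircleDensity R x) :=
    (continuous_semicircleDensity R).measurable.ennreal_ofReal
  refine (integrable_withDensity_iff_integrable_smul' hm (by simp)).2 ?_
  simpa [ENNReal.toReal_ofReal (semicircleDensity_nonneg R _)] using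
    integrable_semicircleDensity_mul hR hf

theorem integral_semicircleLaw {R : ℝ} (hR : 0 < R) {f : ℝ → ℝ} (hf : Continuous f) :
    ∫ x, f x ∂(semicircleLaw R) =
      2 / Real.pi * ∫ θ in (0 : ℝ)..Real.pi, f (R * Real.cos θ) * Real.sin θ ^ 2 := by
  have hm : Measurable fun x => ENNReal.ofReal (semicircleDensity R x) :=
    (continuous_semicircleDensity R).measurable.ennreal_ofReal
  have h1 : ∫ x, f x ∂(semicircleLaw R) = ∫ x, semicircleDensity R x * f x := by
    refine (integral_withDensity_eq_integral_toReal_smul hm (by simp) f).trans ?_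
    simp [ENNReal.toReal_ofReal (semicircleDensity_nonneg R _)]
  have h2 : ∫ x, semicircleDensity R x * f x = ∫ x in (-R)..R, semicircleDensity R x * f x := by
    rw [intervalIntegral.integral_of_le (by linarith), ← integral_Icc_eq_integral_Ioc,
      setIntegral_eq_integral_of_forall_compl_eq_zero]
    intro x hx
    rw [semicircleDensity_eq_zero hR hx, zero_mul]
  have h3 := intervalIntegral.integral_comp_mul_deriv (a := 0) (b := Real.pi)
    (f := fun θ => R * Real.cos θ) (f' := fun θ => R * -Real.sin θ)
    (g := fun x => semicircleDensity R x * f x)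
    (fun θ _ => (Real.hasDerivAt_cos θ).const_mul R) (by fun_prop)
    ((continuous_semicircleDensity R).mul hf)
  simp only [Real.cos_zero, Real.cos_pi, mul_one, mul_neg] at h3
  -- Substitution `x = R cos θ`; the cosine reverses orientation, and this sign cancels that of the
  -- derivative.
  rw [h1, h2, intervalIntegral.integral_symm, ← h3, ← intervalIntegral.integral_const_mul,
    ← intervalIntegral.integral_neg]
  refine intervalIntegral.integral_congr fun θ hθ => ?_
  rw [Set.uIcc_of_le Real.pi_pos.le] at hθ
  have hs : Real.sqrt (R ^ 2 - (R * Real.cos θ) ^ 2) = R * Real.sin θ := by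
    rw [← Real.sqrt_sq (mul_nonneg hR.le (Real.sin_nonneg_of_mem_Icc hθ))]
    congr 1
    rw [mul_pow, mul_pow, Real.sin_sq]
    ring
  have := Real.pi_pos.ne'
  simp only [Function.comp_apply, semicircleDensity, hs]
  field_simp

/-! ### Chebyshev polynomials under the semicircle law -/

theorem integral_sin_mul_sin (k : ℕ) :
    ∫ θ in (0 : ℝ)..Real.pi, Real.sin ((k + 1) * θ) * Real.sin θ =
      if k = 0 then Real.pi / 2 else 0 := by
  have hcos : ∀ m : ℕ, m ≠ 0 → ∫ θ in (0 : ℝ)..Real.pi, Real.cos (m * θ) = 0 := by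
    intro m hm
    have hm' : (m : ℝ) ≠ 0 := Nat.cast_ne_zero.2 hm
    rw [intervalIntegral.integral_comp_mul_left (fun x => Real.cos x) hm']
    simp [Real.sin_nat_mul_pi]
  have h : ∀ θ : ℝ, Real.sin ((k + 1) * θ) * Real.sin θ =
      2⁻¹ * (Real.cos (k * θ) - Real.cos ((k + 2 : ℕ) * θ)) := by
    intro θ
    have e1 : (k : ℝ) * θ = (k + 1) * θ - θ := by ring
    have e2 : ((k + 2 : ℕ) : ℝ) * θ = (k + 1) * θ + θ := by push_cast; ring
    rw [e1, e2, Real.cos_sub, Real.cos_add]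
    ring
  simp_rw [h]
  rw [intervalIntegral.integral_const_mul, intervalIntegral.integral_sub
    (Continuous.intervalIntegrable (by fun_prop) _ _)
    (Continuous.intervalIntegrable (by fun_prop) _ _), hcos (k + 2) (by omega)]
  split_ifs with hk
  · subst hk
    simp
    ring
  · simp [hcos k hk]

/-- With `x = 2a cos θ`, the identity `S_k(2 cos θ) sin θ = sin((k+1)θ)` reduces this to
orthogonality of sines. -/
theorem integral_chebyshevS_semicircleLaw {a : ℝ} (ha : 0 < a) (k : ℕ) :
    ∫ x, (Chebyshev.S ℝ k).eval (x / a) ∂(semicircleLaw (2 * a)) = if k = 0 then 1 else 0 := by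
  rw [integral_semicircleLaw (f := fun x => (Chebyshev.S ℝ k).eval (x / a)) (by linarith)
    ((Chebyshev.S ℝ k).continuous.comp (continuous_id.div_const a))]
  have h : ∀ θ : ℝ, (Chebyshev.S ℝ k).eval (2 * a * Real.cos θ / a) * Real.sin θ ^ 2 =
      Real.sin ((k + 1) * θ) * Real.sin θ := by
    intro θ
    have e : 2 * a * Real.cos θ / a = 2 * Real.cos θ := by field_simp
    have := Chebyshev.S_two_mul_real_cos θ k
    push_cast at this
    rw [e, pow_two, ← mul_assoc, this]
  simp_rw [h]
  rw [integral_sin_mul_sin]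
  have := Real.pi_pos.ne'
  split_ifs
  · field_simp
  · rw [mul_zero]

/-- This is the case `k = 0` above. An infinite mass would have real value 0, so the value 1 also
gives finiteness. -/
theorem isProbabilityMeasure_semicircleLaw {a : ℝ} (ha : 0 < a) :
    IsProbabilityMeasure (semicircleLaw (2 * a)) := by
  have h := integral_chebyshevS_semicircleLaw ha 0
  simp only [Nat.cast_zero, Chebyshev.S_zero, eval_one, integral_const, smul_eq_mul, mul_one,
    if_true] at h
  exact ⟨(ENNReal.toReal_eq_one_iff _).1 h⟩

end MatricialFreeness

namespace MatricialFreeness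

open ContinuousLinearMap (adjoint)

universe u v

/-! ### Isometries between labelled orthonormal bases -/

theorem basisMap_basisVec {X : Type u} {Y : Type v} (f : X → Y) (hf : Function.Injective f)
    (x : X) : basisMap f hf (basisVec x) = basisVec (f x) := by
  classical
  exact (((orthonormal_basisVec Y).comp f hf).orthogonalFamily.linearIsometry_apply_single
    (i := x) (1 : ℂ)).trans (by simp)

theorem ext_basisVec {X : Type u} {E : Type*} [NormedAddCommGroup E] [InnerProductSpace ℂ E]
    {S T : ℓ²(X, ℂ) →L[ℂ] E} (h : ∀ x, S (basisVec x) = T (basisVec x)) : S = T := by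
  classical
  refine lp.ext_continuousLinearMap (by norm_num) fun x => ?_
  ext
  simpa [basisVec] using h x

theorem ext_inner_basisVec {X : Type u} {a b : ℓ²(X, ℂ)}
    (h : ∀ x, inner ℂ (basisVec x) a = inner ℂ (basisVec x) b) : a = b := by
  classical
  ext x
  simpa [basisVec, lp.inner_single_left] using h x

theorem inner_basisVec {X : Type u} (x y : X) [Decidable (x = y)] :
    inner ℂ (basisVec x) (basisVec y) = if x = y then (1 : ℂ) else 0 := by
  classical
  convert orthonormal_iff_ite.1 (orthonormal_basisVec X) x y

theorem adjoint_basisMap_basisVec {X : Type u} {Y : Type v} (f : X → Y)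
    (hf : Function.Injective f) (x : X) :
    adjoint (basisMap f hf).toContinuousLinearMap (basisVec (f x)) = basisVec x := by
  classical
  refine ext_inner_basisVec fun z => ?_
  rw [ContinuousLinearMap.adjoint_inner_right, LinearIsometry.coe_toContinuousLinearMap,
    basisMap_basisVec, inner_basisVec, inner_basisVec]
  simp [hf.eq_iff]

theorem adjoint_basisMap_basisVec_of_notMem {X : Type u} {Y : Type v} (f : X → Y)
    (hf : Function.Injective f) {y : Y} (hy : y ∉ Set.range f) :
    adjoint (basisMap f hf).toContinuousLinearMap (basisVec y) = 0 := by
  classical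
  refine ext_inner_basisVec fun z => ?_
  rw [ContinuousLinearMap.adjoint_inner_right, LinearIsometry.coe_toContinuousLinearMap,
    basisMap_basisVec, inner_basisVec, if_neg fun h => hy ⟨z, h⟩, inner_zero_right]

/-! ### Words of the matricially free-boolean Fock space -/

variable {I : Type u} {J : Set (I × I)}

/-- The words `p₁ p₂ ⋯ pₘ` of consecutive pairs which end with a diagonal pair. -/
def IsPath (v : List J) : Prop :=
  v.IsChain (fun p q => p.1.2 = q.1.1) ∧ ∀ p ∈ v.getLast?, p.1.1 = p.1.2

theorem isPath_nil : IsPath ([] : List J) := by simp [IsPath]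

theorem isPath_singleton {p : J} : IsPath [p] ↔ p.1.1 = p.1.2 := by simp [IsPath]

theorem isPath_cons_cons {p q : J} {v : List J} :
    IsPath (p :: q :: v) ↔ p.1.2 = q.1.1 ∧ IsPath (q :: v) := by
  simp [IsPath, List.getLast?_cons_cons, and_assoc]

theorem IsPath.tail {p : J} {v : List J} (h : IsPath (p :: v)) : IsPath v := by
  cases v with
  | nil => exact isPath_nil
  | cons q v => exact (isPath_cons_cons.1 h).2

theorem isPath_replicate_append {p : J} (hp : p.1.1 = p.1.2) {v : List J} (h : IsPath (p :: v)) :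
    ∀ k : ℕ, IsPath (List.replicate k p ++ v)
  | 0 => h.tail
  | 1 => h
  | k + 2 => by
    have := isPath_replicate_append hp h (k + 1)
    simp only [List.replicate_succ, List.cons_append] at this ⊢
    exact isPath_cons_cons.2 ⟨hp.symm, this⟩

theorem isPath_flatten_cons {p : J} {v : List J} (hv : IsPath (p :: v)) (n : FockLabel J p) :
    IsPath (List.replicate n.1 p ++ v) := by
  by_cases hp : p.1.1 = p.1.2
  · exact isPath_replicate_append hp hv _
  · rw [n.2.2 hp]
    exact hv

theorem flatten_cons (x : Σ p : J, FockLabel J p) (w : List (Σ p : J, FockLabel J p)) :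
    flatten (x :: w) = List.replicate x.2.1 x.1 ++ flatten w := rfl

theorem head?_flatten (w : List (Σ p : J, FockLabel J p)) :
    (flatten w).head? = w.head?.map Sigma.fst := by
  cases w with
  | nil => rfl
  | cons x w =>
    obtain ⟨n, hn⟩ : ∃ n, x.2.1 = n + 1 := ⟨x.2.1 - 1, by have := x.2.2.1; omega⟩
    simp [flatten_cons, hn, List.replicate_succ]

theorem isPath_flatten : ∀ w : List (Σ p : J, FockLabel J p),
    w.IsChain (fun x y => x.1 ≠ y.1 ∧ x.1.1.2 = y.1.1.1) →
    (∀ x ∈ w.getLast?, x.1.1.1 = x.1.1.2) → IsPath (flatten w)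
  | [], _, _ => isPath_nil
  | [x], _, h => by
    rw [flatten_cons]
    exact isPath_flatten_cons (isPath_singleton.2 (h x rfl)) _
  | x :: y :: w, hc, hl => by
    rw [List.isChain_cons_cons] at hc
    have ih := isPath_flatten (y :: w) hc.2 (by simpa [List.getLast?_cons_cons] using hl)
    rw [flatten_cons]
    refine isPath_flatten_cons ?_ _
    have hh := head?_flatten (y :: w)
    cases hf : flatten (y :: w) with
    | nil => simp [hf] at hh
    | cons q v =>
      simp only [hf, List.head?_cons, Option.map_some, Option.some.injEq] at hh
      rw [hf] at ih
      exact isPath_cons_cons.2 ⟨by rw [hh]; exact hc.1.2, ih⟩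

/-- The range of τ is spanned by all paths: grouping equal neighbours of a path recovers a label,
built here by prepending one letter at a time. -/
theorem exists_flatten_eq : ∀ {v : List J}, IsPath v → ∃ w : FBLabel J, flatten w.1 = v
  | [], _ => ⟨⟨[], by simp, by simp⟩, rfl⟩
  | p :: v, h => by
    obtain ⟨⟨w, hc, hl⟩, hw⟩ := exists_flatten_eq h.tail
    simp only at hw
    cases w with
    | nil =>
      obtain rfl : v = [] := hw.symm
      exact ⟨⟨[⟨p, 1, le_refl 1, fun _ => rfl⟩], by simp, by simpa using isPath_singleton.1 h⟩, rfl⟩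
    | cons x w =>
      have hh := head?_flatten (x :: w)
      rw [hw] at hh
      obtain ⟨q, v, rfl⟩ : ∃ q v', v = q :: v' := by
        cases v with
        | nil => simp at hh
        | cons q v' => exact ⟨q, v', rfl⟩
      obtain rfl : q = x.1 := by simpa using hh
      have h1 := (isPath_cons_cons.1 h).1
      by_cases hpx : p = x.1
      · subst hpx
        -- A letter following itself is diagonal by `h1`, so its exponent may exceed one.
        refine ⟨⟨⟨x.1, x.2.1 + 1, by omega, fun hne => (hne h1.symm).elim⟩ :: w, ?_, ?_⟩, ?_⟩
        · rw [List.isChain_cons] at hc ⊢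
          exact hc
        · cases w with
          | nil => simpa using hl
          | cons y w => simpa [List.getLast?_cons_cons] using hl
        · simp only [flatten_cons] at hw ⊢
          rw [List.replicate_succ, List.cons_append, hw]
      · refine ⟨⟨⟨p, 1, le_refl 1, fun _ => rfl⟩ :: x :: w, ?_, ?_⟩, ?_⟩
        · rw [List.isChain_cons_cons]
          exact ⟨⟨hpx, h1⟩, hc⟩
        · simpa [List.getLast?_cons_cons] using hl
        · rw [flatten_cons, hw]
          rfl

theorem mem_range_flatten {v : List J} :
    v ∈ Set.range (fun w : FBLabel J => flatten w.1) ↔ IsPath v :=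
  ⟨fun ⟨w, hw⟩ => hw ▸ isPath_flatten w.1 w.2.1 w.2.2, fun h => exists_flatten_eq h⟩

/-! ### Action of the creation operators on simple tensors -/

/-- The simple tensor of the matricially free-boolean Fock space with label `v`, which is zero if
`v` is not a path. -/
noncomputable def pathVec (v : List J) : FBFock J := adjoint canonicalEmbedding (basisVec v)

theorem pathVec_flatten (w : FBLabel J) : pathVec (flatten w.1) = basisVec w :=
  adjoint_basisMap_basisVec _ flatten_injective w

theorem pathVec_eq_zero {v : List J} (h : ¬ IsPath v) : pathVec v = 0 :=
  adjoint_basisMap_basisVec_of_notMem _ flatten_injective fun h' => h (mem_range_flatten.1 h')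

theorem canonicalEmbedding_pathVec {v : List J} (h : IsPath v) :
    canonicalEmbedding (pathVec v) = basisVec v := by
  obtain ⟨w, rfl⟩ := exists_flatten_eq h
  rw [pathVec_flatten]
  exact basisMap_basisVec _ flatten_injective w

theorem inner_pathVec_self {v : List J} (hv : IsPath v) :
    inner ℂ (pathVec v) (pathVec v) = (1 : ℂ) := by
  classical
  nth_rw 2 [pathVec]
  rw [ContinuousLinearMap.adjoint_inner_right, canonicalEmbedding_pathVec hv, inner_basisVec,
    if_pos rfl]

theorem inner_pathVec_of_ne {v w : List J} (h : v ≠ w) :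
    inner ℂ (pathVec v) (pathVec w) = (0 : ℂ) := by
  classical
  by_cases hv : IsPath v
  · nth_rw 2 [pathVec]
    rw [ContinuousLinearMap.adjoint_inner_right, canonicalEmbedding_pathVec hv, inner_basisVec,
      if_neg h]
  · rw [pathVec_eq_zero hv, inner_zero_left]

theorem vacuum_eq : vacuum J = pathVec [] := (pathVec_flatten _).symm

theorem diagVec_eq (hJ : ∀ j : I, (j, j) ∈ J) (j : I) :
    diagVec hJ j = pathVec [⟨(j, j), hJ j⟩] := (pathVec_flatten _).symm

theorem ext_pathVec {E : Type*} [NormedAddCommGroup E] [InnerProductSpace ℂ E]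
    {S T : FBFock J →L[ℂ] E} (h : ∀ v, IsPath v → S (pathVec v) = T (pathVec v)) : S = T := by
  refine ext_basisVec fun w => ?_
  rw [← pathVec_flatten]
  exact h _ (mem_range_flatten.1 ⟨w, rfl⟩)

theorem creation_pathVec (α : J → ℝ) (p : J) {v : List J} (hv : IsPath v) :
    creation α p (pathVec v) = (α p : ℂ) • pathVec (p :: v) := by
  have : freeCreation p (basisVec v) = basisVec (p :: v) := 
    basisMap_basisVec _ List.cons_injective v
  simp only [creation, smul_apply, ContinuousLinearMap.comp_apply,
    canonicalEmbedding_pathVec hv, this]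
  rfl

theorem adjoint_creation (α : J → ℝ) (p : J) :
    adjoint (creation α p) =
      (α p : ℂ) •
        (adjoint canonicalEmbedding ∘L adjoint (freeCreation p) ∘L canonicalEmbedding) := by
  rw [creation, map_smulₛₗ, ContinuousLinearMap.adjoint_comp, ContinuousLinearMap.adjoint_comp,
    ContinuousLinearMap.adjoint_adjoint, ContinuousLinearMap.comp_assoc, Complex.conj_ofReal]

theorem adjoint_creation_pathVec_cons (α : J → ℝ) (p : J) {v : List J} (hv : IsPath (p :: v)) :
    adjoint (creation α p) (pathVec (p :: v)) = (α p : ℂ) • pathVec v := by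
  have : adjoint (freeCreation p) (basisVec (p :: v)) = basisVec v :=
    adjoint_basisMap_basisVec (fun w : List J => p :: w) List.cons_injective v
  simp only [adjoint_creation, smul_apply, ContinuousLinearMap.comp_apply,
    canonicalEmbedding_pathVec hv, this]
  rfl

theorem adjoint_creation_pathVec_of_head?_ne (α : J → ℝ) (p : J) {v : List J}
    (hp : v.head? ≠ some p) : adjoint (creation α p) (pathVec v) = 0 := by
  by_cases hv : IsPath v
  · have : adjoint (freeCreation p) (basisVec v) = 0 := by
      refine adjoint_basisMap_basisVec_of_notMem _ List.cons_injective ?_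
      rintro ⟨w, rfl⟩
      exact hp rfl
    simp only [adjoint_creation, smul_apply, ContinuousLinearMap.comp_apply,
      canonicalEmbedding_pathVec hv, this, map_zero, smul_zero]
  · rw [pathVec_eq_zero hv, map_zero]

theorem gaussian_pathVec_of_head?_ne (α : J → ℝ) (p : J) {v : List J} (hv : IsPath v)
    (hp : v.head? ≠ some p) : gaussian α p (pathVec v) = (α p : ℂ) • pathVec (p :: v) := by
  rw [gaussian, add_apply, creation_pathVec α p hv,
    adjoint_creation_pathVec_of_head?_ne α p hp, add_zero]

theorem gaussian_pathVec_cons (α : J → ℝ) (p : J) {v : List J} (hv : IsPath (p :: v)) :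
    gaussian α p (pathVec (p :: v)) =
      (α p : ℂ) • pathVec (p :: p :: v) + (α p : ℂ) • pathVec v := by
  rw [gaussian, add_apply, creation_pathVec α p hv,
    adjoint_creation_pathVec_cons α p hv]

theorem isSelfAdjoint_gaussian (α : J → ℝ) (p : J) : IsSelfAdjoint (gaussian α p) :=
  IsSelfAdjoint.add_star_self _

/-! ### The units -/

/-- The labels of the simple tensors on which the algebra at the place `p` acts non-trivially. -/
def unitSupport (p : J) : Set (List J) :=
  {v | IsPath v ∧ (IsPath (p :: v) ∨ v.head? = some p)}

/-- The unit at the place `p`. -/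
noncomputable def unit (p : J) : FBFock J →L[ℂ] FBFock J :=
  (Submodule.span ℂ (pathVec '' unitSupport p)).topologicalClosure.starProjection

theorem isStarProjection_unit (p : J) : IsStarProjection (unit p) :=
  isStarProjection_starProjection

theorem unit_pathVec {p : J} {v : List J} (h : v ∈ unitSupport p) :
    unit p (pathVec v) = pathVec v :=
  Submodule.starProjection_eq_self_iff.2
    (Submodule.le_topologicalClosure _ (Submodule.subset_span ⟨v, h, rfl⟩))

theorem unit_pathVec_of_notMem {p : J} {v : List J} (h : v ∉ unitSupport p) :
    unit p (pathVec v) = 0 := by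
  refine (Submodule.starProjection_apply_eq_zero_iff _).2 ?_
  rw [Submodule.orthogonal_closure]
  refine (Submodule.mem_orthogonal _ _).2 fun x hx => ?_
  induction hx using Submodule.span_induction with
  | mem x hx =>
    obtain ⟨w, hw, rfl⟩ := hx
    exact inner_pathVec_of_ne fun e => h (e ▸ hw)
  | zero => simp
  | add x y _ _ hx hy => rw [inner_add_left, hx, hy, add_zero]
  | smul c x _ hx => rw [inner_smul_left, hx, mul_zero]

theorem unit_pathVec_eq_smul (p : J) (v : List J) :
    ∃ c : ℂ, unit p (pathVec v) = c • pathVec v := by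
  by_cases h : v ∈ unitSupport p
  · exact ⟨1, by rw [unit_pathVec h, one_smul]⟩
  · exact ⟨0, by rw [unit_pathVec_of_notMem h, zero_smul]⟩

/-- Outside the support of the unit both parts of the Gaussian operator vanish: the word with `p`
prepended is not a path, and there is no leading `p` to remove. -/
theorem gaussian_mul_unit (α : J → ℝ) (p : J) : gaussian α p * unit p = gaussian α p := by
  refine ext_pathVec fun v hv => ?_
  rw [mul_apply_eq_comp]
  by_cases h : v ∈ unitSupport p
  · rw [unit_pathVec h]
  · have h' : ¬ IsPath (p :: v) ∧ v.head? ≠ some p := by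
      constructor <;> intro h' <;> exact h ⟨hv, by simp [h']⟩
    rw [unit_pathVec_of_notMem h, map_zero, gaussian_pathVec_of_head?_ne α p hv h'.2,
      pathVec_eq_zero h'.1, smul_zero]

theorem unit_mul_gaussian (α : J → ℝ) (p : J) : unit p * gaussian α p = gaussian α p := by
  have := congrArg star (gaussian_mul_unit α p)
  rwa [star_mul, (isSelfAdjoint_gaussian α p).star_eq,
    (isStarProjection_unit p).isSelfAdjoint.star_eq] at this

theorem unit_mul_comm (p q : J) : unit p * unit q = unit q * unit p := by
  refine ext_pathVec fun v _ => ?_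
  obtain ⟨c, hc⟩ := unit_pathVec_eq_smul p v
  obtain ⟨d, hd⟩ := unit_pathVec_eq_smul q v
  rw [mul_apply_eq_comp, mul_apply_eq_comp, hc, hd, map_smul, map_smul, hc,
    hd, smul_comm]

theorem adjoin_unit_comm {x y : FBFock J →L[ℂ] FBFock J}
    (hx : x ∈ Algebra.adjoin ℂ (Set.range (unit (J := J))))
    (hy : y ∈ Algebra.adjoin ℂ (Set.range (unit (J := J)))) : x * y = y * x := by
  refine Algebra.commute_of_mem_adjoin_of_forall_mem_commute hy fun b hb => ?_
  refine (Algebra.commute_of_mem_adjoin_of_forall_mem_commute hx fun c hc => ?_).symm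
  obtain ⟨p, rfl⟩ := hb
  obtain ⟨q, rfl⟩ := hc
  exact unit_mul_comm p q

/-- Elements of the algebra generated by the units act diagonally on the simple tensors, and so do
their adjoints. -/
theorem adjoin_unit_pathVec {x : FBFock J →L[ℂ] FBFock J}
    (hx : x ∈ Algebra.adjoin ℂ (Set.range (unit (J := J)))) (v : List J) :
    ∃ c : ℂ, x (pathVec v) = c • pathVec v ∧ adjoint x (pathVec v) = star c • pathVec v := by
  induction hx using Algebra.adjoin_induction with
  | mem x hx =>
    obtain ⟨p, rfl⟩ := hx
    have hs : adjoint (unit p) = unit p := (isStarProjection_unit p).isSelfAdjoint.star_eq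
    rw [hs]
    by_cases h : v ∈ unitSupport p
    · exact ⟨1, by simp [unit_pathVec h]⟩
    · exact ⟨0, by simp [unit_pathVec_of_notMem h]⟩
  | algebraMap r =>
    refine ⟨r, by simp [Algebra.algebraMap_eq_smul_one], ?_⟩
    rw [← ContinuousLinearMap.star_eq_adjoint, ← algebraMap_star_comm]
    simp [Algebra.algebraMap_eq_smul_one]
  | add x y _ _ hx hy =>
    obtain ⟨c, hc, hc'⟩ := hx
    obtain ⟨d, hd, hd'⟩ := hy
    exact ⟨c + d, by simp [hc, hd, add_smul], by rw [map_add, add_apply, hc', hd', star_add,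
      add_smul]⟩
  | mul x y _ _ hx hy =>
    obtain ⟨c, hc, hc'⟩ := hx
    obtain ⟨d, hd, hd'⟩ := hy
    refine ⟨c * d, by rw [mul_apply_eq_comp, hd, map_smul, hc, smul_smul, mul_comm], ?_⟩
    rw [← ContinuousLinearMap.star_eq_adjoint, star_mul, mul_apply_eq_comp,
      ContinuousLinearMap.star_eq_adjoint, ContinuousLinearMap.star_eq_adjoint, hc', map_smul, hd',
      smul_smul, star_mul, mul_comm]

end MatricialFreeness

namespace MatricialFreeness

open MeasureTheory Polynomial

universe u

/-! ### Jacobi operators of the free and boolean Fock spaces -/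

/-- The Gaussian operator of the free Fock space over a one-dimensional space, on finite vectors. -/
noncomputable def freeJacobi (a : ℂ) : Module.End ℂ (ℕ →₀ ℂ) :=
  Finsupp.linearCombination ℂ fun k => match k with
    | 0 => a • Finsupp.single 1 1
    | k + 1 => a • Finsupp.single (k + 2) 1 + a • Finsupp.single k 1

/-- The Gaussian operator of the boolean Fock space over a one-dimensional space, extended by zero
to all finite vectors. -/
noncomputable def booleanJacobi (a : ℂ) : Module.End ℂ (ℕ →₀ ℂ) :=
  Finsupp.linearCombination ℂ fun k => match k with
    | 0 => a • Finsupp.single 1 1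
    | 1 => a • Finsupp.single 0 1
    | _ + 2 => 0

/-- The map `U` sends the `k`-th basis vector to `S_k(x/a)`. The three-term recurrence makes it
intertwine the Jacobi operator with multiplication by `x`, and integration against the semicircle
law reads off the zeroth coordinate. -/
theorem integral_freeJacobi_pow {a : ℝ} (ha : 0 < a) (n : ℕ) :
    ((freeJacobi a ^ n) (Finsupp.single 0 1)) 0 =
      ((∫ x, x ^ n ∂(semicircleLaw (2 * a)) : ℝ) : ℂ) := by
  let U : (ℕ →₀ ℂ) →ₗ[ℂ] (ℝ → ℂ) :=
    Finsupp.linearCombination ℂ fun k x => (((Chebyshev.S ℝ k).eval (x / a) : ℝ) : ℂ)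
  have hU : ∀ (x : ℝ) (y : ℕ →₀ ℂ), U (freeJacobi a y) x = x * U y x := by
    intro x y
    have ha' : (a : ℂ) ≠ 0 := by exact_mod_cast ha.ne'
    induction y using Finsupp.induction_linear with
    | zero => simp
    | add y z hy hz => simp only [map_add, Pi.add_apply, hy, hz, mul_add]
    | single k c =>
      cases k with
      | zero =>
        simp only [U, freeJacobi, Finsupp.linearCombination_single, map_smul, Pi.smul_apply,
          smul_eq_mul, Nat.cast_zero, Nat.cast_one, Chebyshev.S_zero, Chebyshev.S_one, eval_X,
          eval_one]
        push_cast
        field_simp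
      | succ k =>
        have h := Chebyshev.S_add_two ℝ (k : ℤ)
        simp only [U, freeJacobi, Finsupp.linearCombination_single, map_smul, Pi.smul_apply,
          smul_eq_mul, map_add, Pi.add_apply]
        have e1 : ((k + 1 : ℕ) : ℤ) = k + 1 := by push_cast; rfl
        have e2 : ((k + 2 : ℕ) : ℤ) = k + 2 := by push_cast; rfl
        rw [e1, e2, h, eval_sub, eval_mul, eval_X, Complex.ofReal_sub, Complex.ofReal_mul,
          Complex.ofReal_div]
        field_simp
        ring
  have hpow : ∀ x : ℝ, U ((freeJacobi a ^ n) (Finsupp.single 0 1)) x = (x : ℂ) ^ n := by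
    intro x
    induction n with
    | zero => simp [U]
    | succ n ih => rw [pow_succ', Module.End.mul_apply, hU, ih, pow_succ']
  have hS : ∀ k : ℕ, Integrable (fun x : ℝ => (Chebyshev.S ℝ k).eval (x / a))
      (semicircleLaw (2 * a)) := fun k => integrable_semicircleLaw (by linarith)
    ((Chebyshev.S ℝ k).continuous.comp (continuous_id.div_const a))
  have hint : ∀ y : ℕ →₀ ℂ, ∫ x, U y x ∂(semicircleLaw (2 * a)) = y 0 := by
    intro y
    simp only [U, Finsupp.linearCombination_apply, Finsupp.sum, Finset.sum_apply, Pi.smul_apply,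
      smul_eq_mul]
    rw [integral_finsetSum _ fun k _ => (hS k).ofReal.const_mul _]
    have : ∀ k : ℕ,
        ∫ x, y k * (((Chebyshev.S ℝ k).eval (x / a) : ℝ) : ℂ) ∂(semicircleLaw (2 * a)) =
          if k = 0 then y k else 0 := by
      intro k
      rw [integral_const_mul, integral_complex_ofReal, integral_chebyshevS_semicircleLaw ha]
      split_ifs <;> simp
    simp only [this, Finset.sum_ite_eq', Finsupp.mem_support_iff]
    split_ifs with h
    · rfl
    · exact (not_not.1 h).symm
  rw [← hint, ← integral_complex_ofReal]
  simp_rw [hpow]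
  simp

theorem booleanJacobi_pow (a : ℂ) (n : ℕ) :
    ((booleanJacobi a ^ n) (Finsupp.single 0 1)) 0 = (a ^ n + (-a) ^ n) / 2 := by
  have h : ∀ n : ℕ, (booleanJacobi a ^ n) (Finsupp.single 0 1) =
      ((a ^ n + (-a) ^ n) / 2) • Finsupp.single 0 1 +
        ((a ^ n - (-a) ^ n) / 2) • Finsupp.single 1 1 := by
    intro n
    induction n with
    | zero => simp
    | succ n ih =>
      rw [pow_succ', Module.End.mul_apply, ih, map_add, map_smul, map_smul]
      simp only [booleanJacobi, Finsupp.linearCombination_single, smul_smul]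
      rw [add_comm]
      congr 2 <;> ring
  simp [h]

theorem hasDistribution_bernoulliLaw {A : Type u} [Ring A] [Algebra ℂ A] {φ : A →ₗ[ℂ] ℂ} {x : A}
    {a : ℝ} (h : ∀ n : ℕ, φ (x ^ n) = ((a : ℂ) ^ n + (-a : ℂ) ^ n) / 2) :
    HasDistribution φ x (bernoulliLaw a) where
  prob := ⟨by simp [bernoulliLaw, ENNReal.inv_two_add_inv_two]⟩
  integrable n := by
    refine Integrable.add_measure ?_ ?_ <;>
    exact (integrable_dirac (by simp)).smul_measure (by simp)
  moment n := by
    rw [h, bernoulliLaw, integral_add_measure, integral_smul_measure, integral_smul_measure,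
      integral_dirac, integral_dirac]
    · simp
      ring
    all_goals exact (integrable_dirac (by simp)).smul_measure (by simp)

/-! ### One-place Fock spaces inside the product Fock space -/

variable {I : Type u} {J : Set (I × I)}

open Classical in
/-- The Gaussian operator of the Fock space at the place `p`, on finite vectors. -/
noncomputable def placeJacobi (α : J → ℝ) (p : J) : Module.End ℂ (ℕ →₀ ℂ) :=
  if p.1.1 = p.1.2 then freeJacobi (α p) else booleanJacobi (α p)

/-- The embedding of the Fock space at the place `p` given by tensoring from the right with the
simple tensor `v`. -/
noncomputable def fockEmbedding (p : J) (v : List J) : (ℕ →₀ ℂ) →ₗ[ℂ] FBFock J :=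
  Finsupp.linearCombination ℂ fun k => pathVec (List.replicate k p ++ v)

theorem fockEmbedding_single_zero (p : J) (v : List J) :
    fockEmbedding p v (Finsupp.single 0 1) = pathVec v := by
  simp [fockEmbedding]

theorem gaussian_fockEmbedding (α : J → ℝ) {p : J} {v : List J} (hv : IsPath (p :: v))
    (hp : v.head? ≠ some p) (x : ℕ →₀ ℂ) :
    gaussian α p (fockEmbedding p v x) = fockEmbedding p v (placeJacobi α p x) := by
  induction x using Finsupp.induction_linear with
  | zero => simp
  | add x y hx hy => simp only [map_add, hx, hy]
  | single k c =>
    have h0 := gaussian_pathVec_of_head?_ne α p hv.tail hp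
    by_cases hd : p.1.1 = p.1.2
    · cases k with
      | zero =>
        simp only [fockEmbedding, placeJacobi, if_pos hd, freeJacobi,
          Finsupp.linearCombination_single, map_smul, one_smul, List.replicate_zero,
          List.replicate_one, List.nil_append, List.cons_append, h0]
      | succ k =>
        have := gaussian_pathVec_cons α p (v := List.replicate k p ++ v)
          (isPath_replicate_append hd hv (k + 1))
        simp only [fockEmbedding, placeJacobi, if_pos hd, freeJacobi, map_add,
          Finsupp.linearCombination_single, map_smul, one_smul, List.replicate_succ,
          List.cons_append, this]
    -- Off the diagonal `p` cannot follow itself, so tensor powers from the second on embed as zero,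
    -- matching the extension of the boolean operator by zero.
    · have h2 : ∀ w, pathVec (p :: p :: w) = 0 :=
        fun w => pathVec_eq_zero fun h => hd (isPath_cons_cons.1 h).1.symm
      match k with
      | 0 =>
        simp only [fockEmbedding, placeJacobi, if_neg hd, booleanJacobi,
          Finsupp.linearCombination_single, map_smul, one_smul, List.replicate_zero,
          List.replicate_one, List.nil_append, List.cons_append, h0]
      | 1 =>
        have := gaussian_pathVec_cons α p hv
        simp only [fockEmbedding, placeJacobi, if_neg hd, booleanJacobi,
          Finsupp.linearCombination_single, map_smul, one_smul, List.replicate_zero,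
          List.replicate_one, List.nil_append, List.cons_append, this, h2, smul_zero, zero_add]
      | k + 2 =>
        simp only [fockEmbedding, placeJacobi, if_neg hd, booleanJacobi,
          Finsupp.linearCombination_single, List.replicate_succ, List.cons_append, h2, smul_zero,
          map_zero]

theorem aeval_gaussian_fockEmbedding (α : J → ℝ) {p : J} {v : List J} (hv : IsPath (p :: v))
    (hp : v.head? ≠ some p) (Q : ℂ[X]) (x : ℕ →₀ ℂ) :
    aeval (gaussian α p) Q (fockEmbedding p v x) =
      fockEmbedding p v (aeval (placeJacobi α p) Q x) := by
  induction Q using Polynomial.induction_on generalizing x with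
  | C c => simp [Algebra.algebraMap_eq_smul_one]
  | add P Q hP hQ => simp [hP, hQ]
  | monomial n c h =>
    rw [pow_succ, ← mul_assoc, map_mul (aeval (gaussian α p)) _ X,
      map_mul (aeval (placeJacobi α p)) _ X, aeval_X, aeval_X, mul_apply_eq_comp,
      gaussian_fockEmbedding α hv hp, h, Module.End.mul_apply]

theorem inner_fockEmbedding {p : J} {v : List J} (hv : IsPath v) (x : ℕ →₀ ℂ) :
    inner ℂ (pathVec v) (fockEmbedding p v x) = x 0 := by
  induction x using Finsupp.induction_linear with
  | zero => simp
  | add x y hx hy => simp only [map_add, inner_add_right, hx, hy, Finsupp.add_apply]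
  | single k c =>
    rw [fockEmbedding, Finsupp.linearCombination_single, inner_smul_right]
    cases k with
    | zero => rw [List.replicate_zero, List.nil_append, inner_pathVec_self hv]; simp
    | succ k =>
      rw [inner_pathVec_of_ne]
      · simp
      · intro h
        have := congrArg List.length h
        simp at this

theorem fockEmbedding_mem_span (p : J) (v : List J) {x : ℕ →₀ ℂ} (hx : x 0 = 0) :
    fockEmbedding p v x ∈ Submodule.span ℂ (pathVec '' {w | IsPath w ∧ w.head? = some p}) := by
  rw [fockEmbedding, Finsupp.linearCombination_apply]
  refine Submodule.sum_mem _ fun k hk => Submodule.smul_mem _ _ ?_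
  obtain ⟨k, rfl⟩ : ∃ l, k = l + 1 := by
    refine ⟨k - 1, ?_⟩
    have : k ≠ 0 := by
      rintro rfl
      simp [hx] at hk
    omega
  by_cases h : IsPath (List.replicate (k + 1) p ++ v)
  · exact Submodule.subset_span ⟨_, ⟨h, by simp [List.replicate_succ]⟩, rfl⟩
  · rw [pathVec_eq_zero h]
    exact Submodule.zero_mem _

/-! ### Distributions of the Gaussian operators -/

/-- The right-hand side does not involve `v`. This carries centering from the one state attached to
`p` to all admissible vectors. -/
theorem vectorState_aeval_gaussian (α : J → ℝ) {p : J} {v : List J} (hv : IsPath (p :: v))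
    (hp : v.head? ≠ some p) (Q : ℂ[X]) :
    vectorState (pathVec v) (aeval (gaussian α p) Q) =
      (aeval (placeJacobi α p) Q (Finsupp.single 0 1)) 0 := by
  rw [← inner_fockEmbedding (p := p) hv.tail, ← aeval_gaussian_fockEmbedding α hv hp,
    fockEmbedding_single_zero]
  rfl

theorem hasDistribution_gaussian_diagonal (α : J → ℝ) {p : J} (hα : 0 < α p)
    (hp : p.1.1 = p.1.2) :
    HasDistribution (vectorState (vacuum J)) (gaussian α p) (semicircleLaw (2 * α p)) where
  prob := isProbabilityMeasure_semicircleLaw hα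
  integrable n := integrable_semicircleLaw (by linarith) (continuous_pow n)
  moment n := by
    have := vectorState_aeval_gaussian α (isPath_singleton.2 hp) (by simp) (X ^ n)
    rw [← integral_freeJacobi_pow hα, vacuum_eq]
    simpa [placeJacobi, hp] using this

theorem hasDistribution_gaussian_offDiagonal (hJ : ∀ j : I, (j, j) ∈ J) (α : J → ℝ) {p : J}
    (hp : p.1.1 ≠ p.1.2) :
    HasDistribution (vectorState (diagVec hJ p.1.2)) (gaussian α p) (bernoulliLaw (α p)) := by
  refine hasDistribution_bernoulliLaw fun n => ?_
  have := vectorState_aeval_gaussian α (p := p) (v := [⟨(p.1.2, p.1.2), hJ p.1.2⟩])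
    (isPath_cons_cons.2 ⟨rfl, isPath_singleton.2 rfl⟩)
    (fun h => hp (by rw [List.head?_cons, Option.some.injEq] at h; rw [← h])) (X ^ n)
  rw [← booleanJacobi_pow, diagVec_eq]
  simpa [placeJacobi, hp] using this

end MatricialFreeness

namespace MatricialFreeness

open Polynomial
open ContinuousLinearMap (adjoint)

universe u

variable {I : Type u} {J : Set (I × I)}

/-! ### The algebras generated by the Gaussian operators and the units -/

theorem isState_vectorState {H : Type u} [NormedAddCommGroup H] [InnerProductSpace ℂ H]
    [CompleteSpace H] {v : H} (hv : inner ℂ v v = (1 : ℂ)) : IsState (vectorState v) where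
  normalized := hv
  positive a := by
    change 0 ≤ inner ℂ v (adjoint a (a v))
    rw [ContinuousLinearMap.adjoint_inner_right, inner_self_eq_norm_sq_to_K]
    norm_cast
    exact Complex.zero_le_real.2 (sq_nonneg ‖a v‖)

/-- The functionals of the array are vector states of simple tensors to which the Gaussian operator
at the given place applies as a creation operator. -/
theorem exists_stateArray_eq [DecidableEq I] (hJ : ∀ j : I, (j, j) ∈ J) (p : J) :
    ∃ v : List J, IsPath (p :: v) ∧ v.head? ≠ some p ∧
      stateArray J (vectorState (vacuum J)) (fun j => vectorState (diagVec hJ j)) p =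
        vectorState (pathVec v) := by
  by_cases hp : p.1.1 = p.1.2
  · exact ⟨[], isPath_singleton.2 hp, by simp, by rw [stateArray, if_pos hp, vacuum_eq]⟩
  · refine ⟨[⟨(p.1.2, p.1.2), hJ p.1.2⟩], isPath_cons_cons.2 ⟨rfl, isPath_singleton.2 rfl⟩,
      fun h => hp ?_, by rw [stateArray, if_neg hp, diagVec_eq]⟩
    rw [List.head?_cons, Option.some.injEq] at h
    rw [← h]

theorem aeval_mul_eq {A : Type*} [Ring A] [Algebra ℂ A] {a e : A} (he : e * e = e)
    (hae : a * e = a) (hea : e * a = a) (Q : ℂ[X]) : e * (aeval a Q * e) = aeval a Q * e := by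
  have hc : Commute e a := hea.trans hae.symm
  have : Commute e (aeval a Q) := by
    induction Q using Polynomial.induction_on' with
    | add P Q hP hQ => simpa using hP.add_right hQ
    | monomial n c =>
      rw [aeval_monomial]
      exact Commute.mul_right (Algebra.commutes c e).symm (hc.pow_right n)
  rw [← mul_assoc, this.eq, mul_assoc, he]

/-- Both generators are self-adjoint, so no adjoints need adding. The form `Q(a) e` is stable under
products because `e` is idempotent and commutes with `Q(a)`. -/
theorem exists_aeval_of_mem_adjoin {A : Type*} [Ring A] [StarRing A] [Algebra ℂ A]
    [StarModule ℂ A] {a e : A} (ha : IsSelfAdjoint a) (he : IsStarProjection e) (hae : a * e = a)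
    (hea : e * a = a) {b : A} (hb : b ∈ NonUnitalStarAlgebra.adjoin ℂ {a, e}) :
    ∃ Q : ℂ[X], b = aeval a Q * e := by
  have hs : ({a, e} : Set A) ∪ star {a, e} = {a, e} := by
    have : star ({a, e} : Set A) = {a, e} := by
      rw [← Set.image_star, Set.image_pair, ha.star_eq, he.isSelfAdjoint.star_eq]
    rw [this, Set.union_self]
  have hb' : b ∈ NonUnitalAlgebra.adjoin ℂ ({a, e} : Set A) := by
    rw [← hs]
    exact hb
  induction hb' using NonUnitalAlgebra.adjoin_induction with
  | mem x hx =>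
    obtain rfl | rfl := hx
    · exact ⟨X, by rw [aeval_X, hae]⟩
    · exact ⟨1, by rw [map_one, one_mul]⟩
  | add x y hx hy hx' hy' =>
    rw [← hs] at hx hy
    obtain ⟨P, rfl⟩ := hx' hx
    obtain ⟨Q, rfl⟩ := hy' hy
    exact ⟨P + Q, by rw [map_add, add_mul]⟩
  | zero => exact ⟨0, by simp⟩
  | mul x y hx hy hx' hy' =>
    rw [← hs] at hx hy
    obtain ⟨P, rfl⟩ := hx' hx
    obtain ⟨Q, rfl⟩ := hy' hy
    exact ⟨P * Q, by
      rw [mul_assoc, aeval_mul_eq he.isIdempotentElem hae hea, map_mul, mul_assoc]⟩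
  | smul c x hx hx' =>
    rw [← hs] at hx
    obtain ⟨P, rfl⟩ := hx' hx
    exact ⟨c • P, by rw [map_smul, smul_mul_assoc]⟩

/-- The algebra generated by the Gaussian operator and the unit at the place `p`. -/
noncomputable abbrev placeAlgebra (α : J → ℝ) (p : J) :
    NonUnitalStarSubalgebra ℂ (FBFock J →L[ℂ] FBFock J) :=
  NonUnitalStarAlgebra.adjoin ℂ {gaussian α p, unit p}

theorem exists_aeval_gaussian {α : J → ℝ} {p : J} {a : FBFock J →L[ℂ] FBFock J}
    (ha : a ∈ placeAlgebra α p) : ∃ Q : ℂ[X], a = aeval (gaussian α p) Q * unit p :=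
  exists_aeval_of_mem_adjoin (isSelfAdjoint_gaussian α p) (isStarProjection_unit p)
    (gaussian_mul_unit α p) (unit_mul_gaussian α p) ha

theorem mul_unit_of_mem {α : J → ℝ} {p : J} {a : FBFock J →L[ℂ] FBFock J}
    (ha : a ∈ placeAlgebra α p) : a * unit p = a := by
  obtain ⟨Q, rfl⟩ := exists_aeval_gaussian ha
  rw [mul_assoc, (isStarProjection_unit p).isIdempotentElem]

theorem unit_mul_of_mem {α : J → ℝ} {p : J} {a : FBFock J →L[ℂ] FBFock J}
    (ha : a ∈ placeAlgebra α p) : unit p * a = a := by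
  obtain ⟨Q, rfl⟩ := exists_aeval_gaussian ha
  exact aeval_mul_eq (isStarProjection_unit p).isIdempotentElem (gaussian_mul_unit α p)
    (unit_mul_gaussian α p) Q

theorem isInternalUnits_unit (α : J → ℝ) : IsInternalUnits (placeAlgebra α) (unit (J := J)) where
  mem p := NonUnitalStarAlgebra.subset_adjoin ℂ _ (by simp)
  projection := isStarProjection_unit
  mul_unit _ _ ha := mul_unit_of_mem ha
  unit_mul _ _ ha := unit_mul_of_mem ha
  commutative _ hx _ hy := adjoin_unit_comm hx hy

/-! ### Action of products of centered elements on the vacuum -/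

/-- The span of the simple tensors whose first factor belongs to the place `p`. -/
noncomputable def headSpan (p : J) : Submodule ℂ (FBFock J) :=
  Submodule.span ℂ (pathVec '' {v | IsPath v ∧ v.head? = some p})

theorem inner_vacuum_headSpan {p : J} {x : FBFock J} (hx : x ∈ headSpan p) :
    inner ℂ (vacuum J) x = (0 : ℂ) := by
  rw [vacuum_eq]
  refine Submodule.mem_orthogonal_singleton_iff_inner_right.1 ((Submodule.span_le.2 ?_) hx)
  rintro _ ⟨v, ⟨-, hv⟩, rfl⟩
  refine Submodule.mem_orthogonal_singleton_iff_inner_right.2 (inner_pathVec_of_ne ?_)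
  rintro rfl
  simp at hv

theorem unit_headSpan_of_eq {p q : J} (h : p.1.2 = q.1.1) {x : FBFock J} (hx : x ∈ headSpan q) :
    unit p x = x := by
  refine LinearMap.eqOn_span (f := (unit p).toLinearMap) (g := LinearMap.id) ?_ hx
  rintro _ ⟨v, ⟨hv, hq⟩, rfl⟩
  obtain ⟨w, rfl⟩ := List.head?_eq_some_iff.1 hq
  exact unit_pathVec ⟨hv, Or.inl (isPath_cons_cons.2 ⟨h, hv⟩)⟩

/-- The condition `p ≠ q` is needed: words headed by an off-diagonal `p` lie in its own support
although `p` does not match itself. -/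
theorem unit_headSpan_of_ne {p q : J} (hpq : p ≠ q) (h : p.1.2 ≠ q.1.1) {x : FBFock J}
    (hx : x ∈ headSpan q) : unit p x = 0 := by
  refine LinearMap.eqOn_span (f := (unit p).toLinearMap) (g := 0) ?_ hx
  rintro _ ⟨v, ⟨hv, hq⟩, rfl⟩
  obtain ⟨w, rfl⟩ := List.head?_eq_some_iff.1 hq
  refine unit_pathVec_of_notMem ?_
  rintro ⟨-, h' | h'⟩
  · exact h (isPath_cons_cons.1 h').1
  · exact hpq (Option.some.inj h').symm

section Centered

variable [DecidableEq I] {hJ : ∀ j : I, (j, j) ∈ J} {α : J → ℝ}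

/-- The component of the image along `v` is the zeroth coordinate of `Q` applied to the Jacobi
operator. It is the same for the vector `w` defining the state at `p`, where it vanishes by
centering. -/
theorem centered_pathVec_mem_headSpan {p : J} {a : FBFock J →L[ℂ] FBFock J}
    (ha : a ∈ placeAlgebra α p)
    (h0 : stateArray J (vectorState (vacuum J)) (fun j => vectorState (diagVec hJ j)) p a = 0)
    {v : List J} (hv : IsPath (p :: v)) (hp : v.head? ≠ some p) : a (pathVec v) ∈ headSpan p := by
  obtain ⟨Q, rfl⟩ := exists_aeval_gaussian ha
  have hact : ∀ w, IsPath (p :: w) → (aeval (gaussian α p) Q * unit p) (pathVec w) =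
      aeval (gaussian α p) Q (pathVec w) := fun w hw => by
    rw [mul_apply_eq_comp, unit_pathVec ⟨hw.tail, Or.inl hw⟩]
  obtain ⟨w, hw, hpw, hφ⟩ := exists_stateArray_eq hJ p
  have h1 : vectorState (pathVec w) (aeval (gaussian α p) Q) = 0 := by
    rw [← h0, hφ]
    exact congrArg (inner ℂ (pathVec w)) (hact w hw).symm
  rw [vectorState_aeval_gaussian α hw hpw] at h1
  rw [hact v hv, ← fockEmbedding_single_zero p v, aeval_gaussian_fockEmbedding α hv hp]
  exact fockEmbedding_mem_span p v h1

theorem centered_headSpan {p q : J} (hpq : p ≠ q) (h : p.1.2 = q.1.1)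
    {a : FBFock J →L[ℂ] FBFock J} (ha : a ∈ placeAlgebra α p)
    (h0 : stateArray J (vectorState (vacuum J)) (fun j => vectorState (diagVec hJ j)) p a = 0)
    {x : FBFock J} (hx : x ∈ headSpan q) : a x ∈ headSpan p := by
  have : headSpan q ≤ (headSpan p).comap a.toLinearMap := by
    refine Submodule.span_le.2 ?_
    rintro _ ⟨v, ⟨hv, hq⟩, rfl⟩
    refine centered_pathVec_mem_headSpan ha h0 ?_ fun h' => hpq ?_
    · obtain ⟨w, rfl⟩ := List.head?_eq_some_iff.1 hq
      exact isPath_cons_cons.2 ⟨h, hv⟩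
    · exact Option.some.inj (h'.symm.trans hq)
  exact this hx

/-- A product of centered elements from neighbouring distinct places maps the vacuum to the span of
the simple tensors whose first factor is at the leftmost place, and to zero if the places do not
form a sequence in `Λ`. -/
theorem wordProd_vacuum : ∀ (p : J) (a : FBFock J →L[ℂ] FBFock J)
    (l : List (J × (FBFock J →L[ℂ] FBFock J))),
    IsCentered (stateArray J (vectorState (vacuum J)) (fun j => vectorState (diagVec hJ j)))
      (placeAlgebra α) ((p, a) :: l) →
    (((p, a) :: l).map Prod.fst).IsChain (· ≠ ·) →
      wordProd ((p, a) :: l) (vacuum J) ∈ headSpan p ∧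
        (¬ InLambda (((p, a) :: l).map Prod.fst) → wordProd ((p, a) :: l) (vacuum J) = 0)
  | p, a, [], hc, _ => by
    obtain ⟨ha, h0⟩ : a ∈ placeAlgebra α p ∧ stateArray J (vectorState (vacuum J))
      (fun j => vectorState (diagVec hJ j)) p a = 0 := hc (p, a) (by simp)
    refine ⟨?_, fun h => (h (by simp [InLambda])).elim⟩
    simp only [wordProd, List.map_cons, List.map_nil, List.prod_cons, List.prod_nil, mul_one,
      vacuum_eq]
    by_cases hp : p.1.1 = p.1.2
    · exact centered_pathVec_mem_headSpan ha h0 (isPath_singleton.2 hp) (by simp)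
    -- An off-diagonal unit kills the vacuum. The word still belongs to Λ, but zero lies in the span
    -- as well.
    · rw [← mul_unit_of_mem ha, mul_apply_eq_comp, unit_pathVec_of_notMem, map_zero]
      · exact Submodule.zero_mem _
      · rintro ⟨-, h | h⟩
        · exact hp (isPath_singleton.1 h)
        · simp at h
  | p, a, (q, b) :: l, hc, hch => by
    obtain ⟨ha, h0⟩ : a ∈ placeAlgebra α p ∧ stateArray J (vectorState (vacuum J))
      (fun j => vectorState (diagVec hJ j)) p a = 0 := hc (p, a) (by simp)
    simp only [List.map_cons, List.isChain_cons_cons] at hch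
    obtain ⟨h1, h2⟩ := wordProd_vacuum q b l (fun x hx => hc x (List.mem_cons_of_mem _ hx))
      (by simpa using hch.2)
    have hm : wordProd ((p, a) :: (q, b) :: l) (vacuum J) =
        a (wordProd ((q, b) :: l) (vacuum J)) := by
      simp [wordProd]
    rw [hm]
    by_cases hpq : p.1.2 = q.1.1
    · refine ⟨centered_headSpan hch.1 hpq ha h0 h1, fun h => ?_⟩
      rw [h2, map_zero]
      intro h'
      refine h ⟨by simp, ?_⟩
      simp only [List.map_cons, List.isChain_cons_cons]
      exact ⟨⟨hch.1, hpq⟩, by simpa using h'.2⟩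
    · have hz : a (wordProd ((q, b) :: l) (vacuum J)) = 0 := by
        rw [← mul_unit_of_mem ha, mul_apply_eq_comp, unit_headSpan_of_ne hch.1 hpq h1, map_zero]
      rw [hz]
      exact ⟨Submodule.zero_mem _, fun _ => rfl⟩

/-! ### Verification of matricial freeness -/

theorem stateArray_diagonal {d : J} (hd : d.1.1 = d.1.2) (a : FBFock J →L[ℂ] FBFock J) :
    stateArray J (vectorState (vacuum J)) (fun j => vectorState (diagVec hJ j)) d a =
      inner ℂ (vacuum J) (a (vacuum J)) := by
  rw [stateArray, if_pos hd]
  rfl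

theorem isMatriciallyFreeUnits_unit (hJ : ∀ j : I, (j, j) ∈ J) (α : J → ℝ) :
    IsMatriciallyFreeUnits
      (stateArray J (vectorState (vacuum J)) (fun j => vectorState (diagVec hJ j)))
      (placeAlgebra α) unit where
  factor d hd a u₁ hu₁ u₂ hu₂ := by
    obtain ⟨c₁, h₁, h₁'⟩ := adjoin_unit_pathVec hu₁ []
    obtain ⟨c₂, h₂, -⟩ := adjoin_unit_pathVec hu₂ []
    have hone : inner ℂ (pathVec ([] : List J)) (pathVec []) = (1 : ℂ) :=
      inner_pathVec_self isPath_nil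
    simp only [stateArray_diagonal hd, mul_apply_eq_comp]
    simp only [vacuum_eq]
    -- The vacuum is an eigenvector of `u₂` and of the adjoint of `u₁`, so both scalars come out of
    -- the inner product.
    rw [← ContinuousLinearMap.adjoint_inner_left, h₁', h₁, h₂, map_smul, inner_smul_left,
      inner_smul_right, inner_smul_right, inner_smul_right, hone, starRingEnd_apply, star_star]
    ring
  unit d hd a p l hl hc hch := by
    obtain ⟨⟨q, b⟩, l, rfl⟩ := List.exists_cons_of_ne_nil hl
    simp only [List.map_cons, List.isChain_cons_cons] at hch
    obtain ⟨h1, h2⟩ := wordProd_vacuum q b l hc (by simpa using hch.2)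
    simp only [stateArray_diagonal hd, mul_apply_eq_comp]
    split_ifs with h
    · have hpq : p.1.2 = q.1.1 := by
        have := h.2
        simp only [List.map_cons, List.isChain_cons_cons] at this
        exact this.1.2
      rw [unit_headSpan_of_eq hpq h1]
    -- Failure of Λ is either a mismatch between `p` and `q`, where the unit gives zero, or a
    -- mismatch further right, where the product already kills the vacuum.
    · by_cases hpq : p.1.2 = q.1.1
      · rw [h2, map_zero, map_zero, inner_zero_right]
        intro h'
        refine h ⟨by simp, ?_⟩
        simp only [List.map_cons, List.isChain_cons_cons]
        exact ⟨⟨hch.1, hpq⟩, by simpa using h'.2⟩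
      · rw [unit_headSpan_of_ne hch.1 hpq h1, map_zero, inner_zero_right]

theorem isMatriciallyFree_gaussian (hJ : ∀ j : I, (j, j) ∈ J) (α : J → ℝ) :
    IsMatriciallyFree
      (stateArray J (vectorState (vacuum J)) (fun j => vectorState (diagVec hJ j)))
      (gaussian α) := by
  refine ⟨unit, ⟨fun p => ?_, isInternalUnits_unit α, fun d hd l hl hc hch => ?_,
    isMatriciallyFreeUnits_unit hJ α⟩⟩
  · obtain ⟨v, hv, -, h⟩ := exists_stateArray_eq hJ p
    rw [h]
    exact isState_vectorState (inner_pathVec_self hv.tail)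
  · obtain ⟨⟨q, b⟩, l, rfl⟩ := List.exists_cons_of_ne_nil hl
    rw [stateArray_diagonal hd]
    exact inner_vacuum_headSpan (wordProd_vacuum q b l hc hch).1

end Centered

end MatricialFreeness

theorem proposition4p1 {I : Type*} [Finite I] [DecidableEq I] (J : Set (I × I))
    (hJ : ∀ j : I, (j, j) ∈ J) (α : J → ℝ) (hα : ∀ p : J, 0 < α p) :
    (∀ j : I, HasDistribution (vectorState (vacuum J)) (gaussian α ⟨(j, j), hJ j⟩)
      (semicircleLaw (2 * α ⟨(j, j), hJ j⟩))) ∧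
    (∀ (i j : I) (hij : (i, j) ∈ J), i ≠ j →
      HasDistribution (vectorState (diagVec hJ j)) (gaussian α ⟨(i, j), hij⟩)
        (bernoulliLaw (α ⟨(i, j), hij⟩))) ∧
    IsMatriciallyFree
      (stateArray J (vectorState (vacuum J)) (fun j => vectorState (diagVec hJ j)))
      (gaussian α) :=
  ⟨fun _ => hasDistribution_gaussian_diagonal α (hα _) rfl,
    fun i j h hij => hasDistribution_gaussian_offDiagonal hJ α (p := ⟨(i, j), h⟩) hij,
    isMatriciallyFree_gaussian hJ α⟩
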